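/- A weight is a continuous, non-increasing function $v:[0,\infty)\to(0,\infty)$ with $\lim_{t\to\infty}t^kv(t)=0$ for all $k\ge 0$. It is normalized if $v=1$ on $[0,1]$, convex if $s\mapsto-\log v(e^s)$ is convex on $\mathbb{R}$, and of moderate growth if there is $H\ge 1$ with $v(Ht)\le e^Hv(t)^2$ for all $t\ge 0$. For $c>0$ put $v_c(t)=v(ct)$. For $v,w:[0,\infty)\to(0,\infty)$ write $v\preceq_{\mathfrak c}w$ if there is $c\ge 1$ with $w(ct)=O(v(t))$ as $t\to\infty$, and $v\sim_{\mathfrak c}w$ if $v\preceq_{\mathfrak c}w$ and $w\preceq_{\mathfrak c}v$. Let $H^\infty_v$ be the Banach space of entire functions $f$ with $\|f\|_v=\sup_{z\in\mathbb{C}}|f(z)|v(|z|)<\infty$. Let $H^\infty_{\underline{\mathcal V}_{\mathfrak c}}=\varinjlim_{n}H^\infty_{v_n}$ (the (LB)-space, $n=1,2,\dots$) and $H^\infty_{\overline{\mathcal V}_{\mathfrak c}}=\varprojlim_nH^\infty_{v_{1/n}}$ (the Fréchet space), and similarly with $u,\mathcal U$ and $w,\mathcal W$. Put $M^v_j=\sup_{t>0}t^jv(t)$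 for $j\in\mathbb{N}=\{0,1,\dots\}$; for positive sequences write $M\preceq N$ if $\sup_{j\ge 1}(M_j/N_j)^{1/j}<\infty$; and put $v_M(t)=\exp(-\omega_M(t))$, where $\omega_M(t)=\sup_{j\in\mathbb{N}}\log(t^j/M_j)$ for $t>0$ and $\omega_M(0)=0$. **Theorem.** Let $u$ and $w$ be normalized weights, with $u$ convex and at least one of $u$, $w$ of moderate growth. Then the following are equivalent: (i) $u\preceq_{\mathfrak c}w$; (ii) $H^\infty_{\underline{\mathcal U}_{\mathfrak c}}\subseteq H^\infty_{\underline{\mathcal W}_{\mathfrak c}}$ with continuous inclusion; (iii) $H^\infty_{\overline{\mathcal U}_{\mathfrak c}}\subseteq H^\infty_{\overline{\mathcal W}_{\mathfrak c}}$ with continuous inclusion. If in addition $w$ is convex, then (i)–(iii) are also equivalent to each of (iv) $M^w\preceq M^u$; (v) $v_{M^u}\preceq_{\mathfrak c}v_{M^w}$. Consequently, if $u$ and $w$ are both normalized, convex and of moderate growth, then $u\sim_{\mathfrak c}w$ holds if and only if $H^\infty_{\underline{\mathcal U}_{\mathfrak c}}=H^\infty_{\underline{\mathcal W}_{\mathfrak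 c}}$ as locally convex vector spaces, and also if and only if $H^\infty_{\overline{\mathcal U}_{\mathfrak c}}=H^\infty_{\overline{\mathcal W}_{\mathfrak c}}$ as locally convex vector spaces. -/

import Mathlib

open Filter Topology Asymptotics
open scoped NNReal

noncomputable section

namespace WeightedEntire

/-- A weight function `v : [0,∞) → (0,∞)`: continuous, non-increasing, rapidly decreasing. -/
structure Weight where
  /-- The underlying function. -/
  toFun : ℝ≥0 → ℝ
  pos : ∀ t, 0 < toFun t
  continuous : Continuous toFun
  antitone : Antitone toFun
  rapid : ∀ k : ℕ, Tendsto (fun t : ℝ≥0 => (t : ℝ) ^ k * toFun t) atTop (𝓝 0)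

instance : CoeFun Weight (fun _ => ℝ≥0 → ℝ) := ⟨Weight.toFun⟩

/-- `v` is normalized: `v = 1` on `[0,1]`. -/
def Weight.Normalized (v : Weight) : Prop := ∀ t : ℝ≥0, t ≤ 1 → v t = 1

/-- `v` is (log-)convex: `s ↦ -log v(e^s)` is convex on `ℝ`. -/
def Weight.IsConvex (v : Weight) : Prop :=
  ConvexOn ℝ Set.univ (fun s : ℝ => -Real.log (v (Real.exp s).toNNReal))

/-- `v` is of moderate growth. -/
def Weight.ModerateGrowth (v : Weight) : Prop :=
  ∃ H : ℝ≥0, 1 ≤ H ∧ ∀ t : ℝ≥0, v (H * t) ≤ Real.exp H * v t ^ 2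

/-- The dilated weight `v_c : t ↦ v (c t)`, `c > 0`. -/
def Weight.dilate (v : Weight) (c : ℝ≥0) (hc : 0 < c) : Weight where
  toFun t := v (c * t)
  pos t := v.pos _
  continuous := v.continuous.comp (continuous_const.mul continuous_id)
  antitone s t h := v.antitone (mul_le_mul_of_nonneg_left h (zero_le))
  rapid k := by
    have h1 : Tendsto (fun t : ℝ≥0 => c * t) atTop atTop :=
      tendsto_id.const_mul_atTop hc
    have h2 := ((v.rapid k).comp h1).const_mul (((c : ℝ) ^ k)⁻¹)
    rw [mul_zero] at h2
    refine h2.congr fun t => ?_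
    have hc' : (c : ℝ) ≠ 0 := by exact_mod_cast hc.ne'
    simp only [Function.comp, NNReal.coe_mul, mul_pow]
    field_simp

/-- `v ≼ w`: `w(t) = O(v(t))` as `t → ∞`. -/
def Prec (v w : ℝ≥0 → ℝ) : Prop := w =O[atTop] v

/-- `v ≼_c w`: there is `c ≥ 1` with `v ≼ w_c`, where `w_c(t) = w(ct)`. -/
def PrecDil (v w : ℝ≥0 → ℝ) : Prop := ∃ c : ℝ≥0, 1 ≤ c ∧ Prec v (fun t => w (c * t))

/-- `v ∼_c w`. -/
def SimDil (v w : ℝ≥0 → ℝ) : Prop := PrecDil v w ∧ PrecDil w v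

/-! Associated weight sequence and associated weight function. -/

/-- `M^v_j = sup_{t > 0} t^j v(t)`. -/
def assocSeq (v : Weight) (j : ℕ) : ℝ := ⨆ t : {t : ℝ≥0 // 0 < t}, ((t : ℝ≥0) : ℝ) ^ j * v t

/-- `M ≼ N` for sequences: `sup_{j ≥ 1} (M_j / N_j)^{1/j} < ∞`. -/
def SeqPrec (M N : ℕ → ℝ) : Prop :=
  BddAbove {x : ℝ | ∃ j : ℕ, 1 ≤ j ∧ x = (M j / N j) ^ (1 / (j : ℝ))}

/-- The associated weight function `ω_M(t) = sup_j log (t^j / M_j)` for `t > 0`, `ω_M(0) = 0`.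
It is only used for `M = M^v`, where the supremum is finite, see `assocFun_bddAbove`. -/
def assocFun (M : ℕ → ℝ) (t : ℝ≥0) : ℝ :=
  if t = 0 then 0 else ⨆ j : ℕ, Real.log ((t : ℝ) ^ j / M j)

/-- `v_M(t) = exp (-ω_M(t))`. -/
def seqWeight (M : ℕ → ℝ) (t : ℝ≥0) : ℝ := Real.exp (-assocFun M t)

theorem assocSeq_bddAbove (v : Weight) (j : ℕ) :
    BddAbove (Set.range fun t : {t : ℝ≥0 // 0 < t} => ((t : ℝ≥0) : ℝ) ^ j * v t) := by
  obtain ⟨T, hT⟩ := eventually_atTop.1 ((v.rapid j).eventually (gt_mem_nhds one_pos))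
  refine ⟨max 1 ((T : ℝ) ^ j * v 0), ?_⟩
  rintro _ ⟨⟨t, ht⟩, rfl⟩
  rcases le_total T t with h | h
  · exact (hT t h).le.trans (le_max_left _ _)
  · refine le_trans ?_ (le_max_right _ _)
    have h' : (t : ℝ) ≤ T := by exact_mod_cast h
    exact mul_le_mul (pow_le_pow_left₀ t.2 h' j) (v.antitone (zero_le)) (v.pos _).le
      (pow_nonneg T.2 j)

theorem le_assocSeq (v : Weight) (j : ℕ) (t : ℝ≥0) (ht : 0 < t) :
    (t : ℝ) ^ j * v t ≤ assocSeq v j :=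
  le_ciSup (assocSeq_bddAbove v j) (⟨t, ht⟩ : {t : ℝ≥0 // 0 < t})

theorem assocFun_bddAbove (v : Weight) (t : ℝ≥0) (ht : 0 < t) :
    BddAbove (Set.range fun j : ℕ => Real.log ((t : ℝ) ^ j / assocSeq v j)) := by
  refine ⟨Real.log (v t)⁻¹, ?_⟩
  rintro _ ⟨j, rfl⟩
  have hp : (0 : ℝ) < (t : ℝ) ^ j := pow_pos (by exact_mod_cast ht) j
  have hM := le_assocSeq v j t ht
  have hM0 : 0 < assocSeq v j := lt_of_lt_of_le (mul_pos hp (v.pos t)) hM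
  refine Real.log_le_log (div_pos hp hM0) ?_
  rw [div_le_iff₀ hM0, inv_mul_eq_div, le_div_iff₀ (v.pos t)]
  exact hM

/-! The Banach space `H^∞_v`. -/

/-- The entire functions `f` with `sup_z |f(z)| v(|z|) < ∞`, as a subspace of all functions. -/
def hInfSubmodule (v : Weight) : Submodule ℂ (ℂ → ℂ) where
  carrier := {f | Differentiable ℂ f ∧ BddAbove (Set.range fun z => ‖f z‖ * v ‖z‖₊)}
  zero_mem' := ⟨differentiable_const 0, 0, by rintro _ ⟨z, rfl⟩; simp⟩
  add_mem' := by
    rintro f g ⟨hf, A, hA⟩ ⟨hg, B, hB⟩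
    refine ⟨hf.add hg, A + B, ?_⟩
    rintro _ ⟨z, rfl⟩
    refine le_trans ?_ (add_le_add (hA ⟨z, rfl⟩) (hB ⟨z, rfl⟩))
    rw [← add_mul]
    exact mul_le_mul_of_nonneg_right (norm_add_le _ _) (v.pos _).le
  smul_mem' := by
    rintro c f ⟨hf, A, hA⟩
    refine ⟨hf.const_smul c, ‖c‖ * A, ?_⟩
    rintro _ ⟨z, rfl⟩
    have := mul_le_mul_of_nonneg_left (hA ⟨z, rfl⟩) (norm_nonneg c)
    simpa [mul_assoc] using this

/-- The space `H^∞_v`; a type synonym, so that it does not carry the topology of pointwise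
convergence. -/
def HInf (v : Weight) : Type := hInfSubmodule v

namespace HInf

variable {v : Weight}

instance : AddCommGroup (HInf v) := inferInstanceAs (AddCommGroup (hInfSubmodule v))

instance : Module ℂ (HInf v) := inferInstanceAs (Module ℂ (hInfSubmodule v))

instance : FunLike (HInf v) ℂ ℂ where
  coe f := f.1
  coe_injective _ _ h := Subtype.ext h

instance : Norm (HInf v) := ⟨fun f => ⨆ z : ℂ, ‖f z‖ * v ‖z‖₊⟩

theorem norm_def (f : HInf v) : ‖f‖ = ⨆ z : ℂ, ‖f z‖ * v ‖z‖₊ := rfl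

theorem le_norm (f : HInf v) (z : ℂ) : ‖f z‖ * v ‖z‖₊ ≤ ‖f‖ := le_ciSup f.2.2 z

theorem normedCore : NormedSpace.Core ℂ (HInf v) where
  norm_nonneg f := Real.iSup_nonneg fun _ => mul_nonneg (norm_nonneg _) (v.pos _).le
  norm_smul c f := by
    rw [norm_def, norm_def, Real.mul_iSup_of_nonneg (norm_nonneg c)]
    refine congrArg _ (funext fun z => ?_)
    rw [show (c • f) z = c * f z from rfl, norm_mul, mul_assoc]
  norm_triangle f g := by
    refine ciSup_le fun z => le_trans ?_ (add_le_add (le_norm f z) (le_norm g z))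
    rw [← add_mul]
    exact mul_le_mul_of_nonneg_right (norm_add_le _ _) (v.pos _).le
  norm_eq_zero_iff f := by
    constructor
    · intro h
      refine DFunLike.ext _ _ fun z => ?_
      have h1 := le_norm f z
      rw [h] at h1
      have h2 : ‖f z‖ = 0 :=
        le_antisymm (nonpos_of_mul_nonpos_left h1 (v.pos _)) (norm_nonneg _)
      exact norm_eq_zero.1 h2
    · rintro rfl
      rw [norm_def]
      simp [show ∀ z, (0 : HInf v) z = 0 from fun _ => rfl]

instance : NormedAddCommGroup (HInf v) := NormedAddCommGroup.ofCore normedCore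

instance : NormedSpace ℂ (HInf v) := NormedSpace.ofCore normedCore

end HInf

/-! The (LB)-space of a non-increasing sequence of weights. -/

/-- The sum of the spaces `H^∞_{v_n}`; it is their union when the weights are non-increasing in `n`,
see `mem_indSubmodule_lowerSystem`. -/
def indSubmodule (V : ℕ+ → Weight) : Submodule ℂ (ℂ → ℂ) := ⨆ n, hInfSubmodule (V n)

/-- The inductive limit of the Banach spaces `H^∞_{v_n}`. -/
def IndLim (V : ℕ+ → Weight) : Type := indSubmodule V

namespace IndLim

variable {V : ℕ+ → Weight}

instance : AddCommGroup (IndLim V) := inferInstanceAs (AddCommGroup (indSubmodule V))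

instance : Module ℂ (IndLim V) := inferInstanceAs (Module ℂ (indSubmodule V))

instance : FunLike (IndLim V) ℂ ℂ where
  coe f := f.1
  coe_injective _ _ h := Subtype.ext h

/-- The inclusion of the step `H^∞_{v_n}`. -/
def incl (n : ℕ+) : HInf (V n) →ₗ[ℂ] IndLim V :=
  Submodule.inclusion (le_iSup (fun n => hInfSubmodule (V n)) n)

/-- The finest locally convex vector space topology for which the inclusions of all steps are
continuous. -/
instance : TopologicalSpace (IndLim V) :=
  sInf {t : TopologicalSpace (IndLim V) |
    (∀ n, Continuous[inferInstance, t] (incl n : HInf (V n) → IndLim V)) ∧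
    @IsTopologicalAddGroup (IndLim V) t _ ∧
    @ContinuousSMul ℂ (IndLim V) _ _ t ∧
    @LocallyConvexSpace ℝ (IndLim V) _ _ _ _ t}

instance : IsTopologicalAddGroup (IndLim V) := topologicalAddGroup_sInf fun _ ht => ht.2.1

instance : ContinuousSMul ℂ (IndLim V) := continuousSMul_sInf fun _ ht => ht.2.2.1

instance : LocallyConvexSpace ℝ (IndLim V) := .sInf fun _ ht => ht.2.2.2

theorem continuous_incl (n : ℕ+) : Continuous (incl n : HInf (V n) → IndLim V) :=
  continuous_sInf_rng.2 fun _ ht => ht.1 n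

end IndLim

/-! The Fréchet space of a non-decreasing sequence of weights. -/

/-- The intersection of the spaces `H^∞_{v_n}`. -/
def projSubmodule (V : ℕ+ → Weight) : Submodule ℂ (ℂ → ℂ) := ⨅ n, hInfSubmodule (V n)

/-- The projective limit of the Banach spaces `H^∞_{v_n}`. -/
def ProjLim (V : ℕ+ → Weight) : Type := projSubmodule V

namespace ProjLim

variable {V : ℕ+ → Weight}

instance : AddCommGroup (ProjLim V) := inferInstanceAs (AddCommGroup (projSubmodule V))

instance : Module ℂ (ProjLim V) := inferInstanceAs (Module ℂ (projSubmodule V))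

instance : FunLike (ProjLim V) ℂ ℂ where
  coe f := f.1
  coe_injective _ _ h := Subtype.ext h

/-- The inclusion into the step `H^∞_{v_n}`. -/
def proj (n : ℕ+) : ProjLim V →ₗ[ℂ] HInf (V n) :=
  Submodule.inclusion (iInf_le (fun n => hInfSubmodule (V n)) n)

/-- The coarsest topology for which the inclusions into all steps are continuous. -/
instance : TopologicalSpace (ProjLim V) :=
  ⨅ n, TopologicalSpace.induced (proj n : ProjLim V → HInf (V n)) inferInstance

end ProjLim

/-- The dilatation-type system `(v_n)_{n ≥ 1}`, `v_n(t) = v(nt)`. -/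
def lowerSystem (v : Weight) (n : ℕ+) : Weight :=
  v.dilate (n : ℕ) (by exact_mod_cast n.pos)

/-- The dilatation-type system `(v_{1/n})_{n ≥ 1}`, `v_{1/n}(t) = v(t/n)`. -/
def upperSystem (v : Weight) (n : ℕ+) : Weight :=
  v.dilate (1 / (n : ℕ)) (by have : (0 : ℝ≥0) < (n : ℕ) := by exact_mod_cast n.pos
                             positivity)

theorem hInfSubmodule_mono {v w : Weight} (h : ∀ t, w t ≤ v t) :
    hInfSubmodule v ≤ hInfSubmodule w := by
  rintro f ⟨hf, A, hA⟩
  refine ⟨hf, A, ?_⟩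
  rintro _ ⟨z, rfl⟩
  exact (mul_le_mul_of_nonneg_left (h _) (norm_nonneg _)).trans (hA ⟨z, rfl⟩)

theorem mem_indSubmodule_lowerSystem (v : Weight) (f : ℂ → ℂ) :
    f ∈ indSubmodule (lowerSystem v) ↔ ∃ n, f ∈ hInfSubmodule (lowerSystem v n) := by
  refine Submodule.mem_iSup_of_directed _ (Monotone.directed_le fun m n hmn => ?_)
  refine hInfSubmodule_mono fun t => v.antitone ?_
  have : ((m : ℕ) : ℝ≥0) ≤ (n : ℕ) := by exact_mod_cast hmn
  exact mul_le_mul_of_nonneg_right this (zero_le)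

/-- The space `E` of functions is contained in the space `F`, with continuous inclusion. -/
def ContinuouslyIncluded (E F : Type) [AddCommGroup E] [Module ℂ E] [TopologicalSpace E]
    [FunLike E ℂ ℂ] [AddCommGroup F] [Module ℂ F] [TopologicalSpace F] [FunLike F ℂ ℂ] : Prop :=
  ∃ i : E →L[ℂ] F, ∀ (f : E) (z : ℂ), i f z = f z

/-- The function spaces `E` and `F` have the same elements and the same topology. -/
def EqualAsLCVS (E F : Type) [AddCommGroup E] [Module ℂ E] [TopologicalSpace E]
    [FunLike E ℂ ℂ] [AddCommGroup F] [Module ℂ F] [TopologicalSpace F] [FunLike F ℂ ℂ] : Prop :=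
  ∃ e : E ≃L[ℂ] F, ∀ (f : E) (z : ℂ), e f z = f z

end WeightedEntire

end

open WeightedEntire

/-!
Both inclusions are tested against the moments `M_j = sup t ^ j u(t)` of `u`. Every condition in the
theorem yields constants `c` and `C` such that, for all large `t` and all `j`,

  `t ^ j * w (c * t) ≤ C * M_j`.

For the inductive limits this comes from the single entire function `∑ z ^ j / (2 ^ j M_j)`: it lies
in `H^∞_u`, and at `2 t` it is at least `t ^ j / M_j` for each `j` (`pow_le_norm_extremalFun`), so
its mere membership in some `H^∞_{w_n}` gives the bound. For the projective limits
the test functions are the monomials, whose norm in `H^∞_{u_{1/n}}` is at most `n ^ j M_j`; here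
continuity at `0` provides one `n` that works for all `j` (`exists_norm_proj_lt_subset`). For the
sequences and their associated weights the bound follows from the definitions.

The bound returns to the weights because `u` is convex: a supporting line of `s ↦ -log u(e ^ s)` at
`log t`, with its slope rounded down to an integer `j`, shows `M_j ≤ t ^ (j + 1) u(t)`
(`exists_assocSeq_le`). Hence `w (c * t) ≤ C t u(t)` for large `t`, and moderate growth of either
weight removes the factor `t` at the price of a larger dilation (`precDil_of_eventually_le_mul`).
Together this is `precDil_of_eventually_le_assocSeq`.

In the other direction, `w (c * t) ≤ C u(t)` holds for all `t` with `c` an integer, so that each step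
of one system embeds continuously into a step of the other. Equality of the spaces is inclusion both
ways (`equalAsLCVS_iff`).
-/

noncomputable section

namespace WeightedEntire

/-! ### Weights and their associated sequences -/

theorem assocSeq_pos (v : Weight) (j : ℕ) : 0 < assocSeq v j :=
  lt_of_lt_of_le (by simpa using v.pos 1) (le_assocSeq v j 1 one_pos)

theorem assocSeq_le {v : Weight} {j : ℕ} {B : ℝ}
    (h : ∀ t : ℝ≥0, 0 < t → (t : ℝ) ^ j * v t ≤ B) : assocSeq v j ≤ B := by
  have : Nonempty {t : ℝ≥0 // 0 < t} := ⟨⟨1, one_pos⟩⟩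
  exact ciSup_le fun t => h t t.2

/-- The supremum defining `assocSeq` runs over `t > 0`, but the bound extends to `t = 0`. -/
theorem le_assocSeq_of_normalized {v : Weight} (hv : v.Normalized) (j : ℕ) (t : ℝ≥0) :
    (t : ℝ) ^ j * v t ≤ assocSeq v j := by
  rcases eq_or_ne t 0 with rfl | ht
  · have h1 := le_assocSeq v j 1 one_pos
    rw [hv 1 le_rfl] at h1
    rw [hv 0 zero_le_one]
    refine le_trans (mul_le_mul_of_nonneg_right ?_ zero_le_one) h1
    simpa using pow_le_one₀ (n := j) le_rfl zero_le_one
  · exact le_assocSeq v j t (pos_iff_ne_zero.2 ht)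

theorem assocSeq_zero {v : Weight} (hv : v.Normalized) : assocSeq v 0 = 1 := by
  refine le_antisymm (assocSeq_le fun t _ => ?_) ?_
  · simpa [hv 0 zero_le_one] using v.antitone (zero_le (a := t))
  · simpa [hv 1 le_rfl] using le_assocSeq v 0 1 one_pos

theorem eventually_mul_comp_mul_le_one (v : Weight) {c : ℝ≥0} (hc : 1 ≤ c) :
    ∀ᶠ t : ℝ≥0 in atTop, (t : ℝ) * v (c * t) ≤ 1 := by
  have h : Tendsto (fun t : ℝ≥0 => c * t) atTop atTop :=
    tendsto_id.const_mul_atTop (zero_lt_one.trans_le hc)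
  filter_upwards [h.eventually ((v.rapid 1).eventually (gt_mem_nhds one_pos))] with t ht
  refine le_trans (mul_le_mul_of_nonneg_right ?_ (v.pos _).le) ht.le
  rw [pow_one]
  exact_mod_cast le_mul_of_one_le_left (zero_le (a := t)) hc

/-- Existence of a supporting line. -/
theorem exists_affine_le_of_convexOn_univ {f : ℝ → ℝ} (hf : ConvexOn ℝ Set.univ f) (x : ℝ) :
    ∃ a : ℝ, ∀ y, f x + a * (y - x) ≤ f y := by
  refine ⟨derivWithin f (Set.Ioi x) x, fun y => ?_⟩
  have hx : x ∈ interior (Set.univ : Set ℝ) := by simp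
  rcases lt_trichotomy x y with h | rfl | h
  · have := hf.rightDeriv_le_slope_of_mem_interior hx (Set.mem_univ y) h
    rw [slope_def_field, le_div_iff₀ (sub_pos.2 h)] at this
    linarith
  · simp
  · have := (hf.slope_le_leftDeriv_of_mem_interior (Set.mem_univ y) hx h).trans
      (hf.leftDeriv_le_rightDeriv_of_mem_interior hx)
    rw [slope_def_field, div_le_iff₀ (sub_pos.2 h)] at this
    linarith

/-- For a convex weight the infimum over integers `j` of `M_j / t ^ j` recovers `v t` up to a
factor `t`. With real exponents in place of `j` there would be no loss: the slope `a` of a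
supporting line of `s ↦ -log v (e ^ s)` at `log t` is optimal. Rounding `a` down costs `t`. -/
theorem exists_assocSeq_le {v : Weight} (hv : v.Normalized) (hvc : v.IsConvex) {t : ℝ≥0}
    (ht : 1 ≤ t) : ∃ j : ℕ, assocSeq v j ≤ (t : ℝ) ^ (j + 1) * v t := by
  have ht1 : (1 : ℝ) ≤ t := by exact_mod_cast ht
  have hx : 0 ≤ Real.log t := Real.log_nonneg ht1
  obtain ⟨a, ha⟩ := exists_affine_le_of_convexOn_univ hvc (Real.log t)
  have hexp : ∀ s : ℝ≥0, 0 < s → (Real.exp (Real.log s)).toNNReal = s := fun s hs => by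
    rw [Real.exp_log (by exact_mod_cast hs), Real.toNNReal_coe]
  have ha0 : 0 ≤ a := by
    have h1 := ha (Real.log t - 1)
    have h2 : Real.log (v (Real.exp (Real.log t)).toNNReal) ≤
        Real.log (v (Real.exp (Real.log t - 1)).toNNReal) :=
      Real.log_le_log (v.pos _) (v.antitone (Real.toNNReal_le_toNNReal
        (Real.exp_le_exp.2 (by linarith))))
    linarith
  have hj1 := Nat.floor_le ha0
  have hj2 := (Nat.lt_floor_add_one a).le
  set j := ⌊a⌋₊
  -- In logarithms the claim is `(a - j) * (log s - log t) + log t ≥ 0`, with `0 ≤ a - j ≤ 1`.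
  have key : ∀ s : ℝ≥0, 1 ≤ s → (s : ℝ) ^ j * v s ≤ (t : ℝ) ^ (j + 1) * v t := by
    intro s hs
    have hs1 : (1 : ℝ) ≤ s := by exact_mod_cast hs
    have hy : 0 ≤ Real.log s := Real.log_nonneg hs1
    have h1 := ha (Real.log s)
    simp only [hexp t (zero_lt_one.trans_le ht), hexp s (zero_lt_one.trans_le hs)] at h1
    have hs0 : (0 : ℝ) < s := by linarith
    have ht0 : (0 : ℝ) < t := by linarith
    have hvs := v.pos s
    have hvt := v.pos t
    rw [← Real.log_le_log_iff (by positivity) (by positivity),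
      Real.log_mul (by positivity) hvs.ne', Real.log_mul (by positivity) hvt.ne',
      Real.log_pow, Real.log_pow]
    push_cast
    rcases le_total (Real.log t) (Real.log s) with h | h <;> nlinarith
  refine ⟨j, assocSeq_le fun s hs => ?_⟩
  rcases le_total 1 s with h | h
  · exact key s h
  · refine le_trans ?_ (key 1 le_rfl)
    rw [hv s h, hv 1 le_rfl]
    exact mul_le_mul_of_nonneg_right
      (pow_le_pow_left₀ s.2 (by exact_mod_cast h) j) zero_le_one

/-! ### The order relation on weights in terms of moments -/

/-- The asymptotic comparison, made global with an integer dilation. -/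
theorem exists_forall_le_of_precDil {u w : Weight} (h : PrecDil u w) :
    ∃ c : ℕ+, ∃ C : ℝ, 0 < C ∧ ∀ t : ℝ≥0, w ((c : ℕ) * t) ≤ C * u t := by
  obtain ⟨c, -, hc⟩ := h
  obtain ⟨C, hC, hb⟩ := hc.exists_pos
  obtain ⟨T, hT⟩ := eventually_atTop.1 hb.bound
  obtain ⟨n, hn⟩ := exists_nat_ge c
  have hmono : ∀ t, w ((n + 1 : ℕ) * t) ≤ w (c * t) := fun t =>
    w.antitone (mul_le_mul_of_nonneg_right (hn.trans (by push_cast; simp)) zero_le)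
  -- Below the threshold `T` the quotient is at most `w 0 / u T`.
  refine ⟨⟨n + 1, n.succ_pos⟩, max C (w 0 / u T), lt_max_of_lt_left hC, fun t => ?_⟩
  rcases le_total T t with h | h
  · have := hT t h
    rw [Real.norm_of_nonneg (w.pos _).le, Real.norm_of_nonneg (u.pos _).le] at this
    exact (hmono t).trans (this.trans
      (mul_le_mul_of_nonneg_right (le_max_left _ _) (u.pos _).le))
  · refine le_trans ?_ (mul_le_mul_of_nonneg_right (le_max_right _ _) (u.pos _).le)
    rw [div_mul_eq_mul_div, le_div_iff₀ (u.pos T)]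
    exact mul_le_mul (w.antitone zero_le) (u.antitone h) (u.pos _).le (w.pos _).le

/-- Moderate growth of either weight absorbs a polynomial factor into the dilation. -/
theorem precDil_of_eventually_le_mul {u w : Weight} (hmg : u.ModerateGrowth ∨ w.ModerateGrowth)
    {c : ℝ≥0} (hc : 1 ≤ c) {C : ℝ} (hC : 0 < C)
    (h : ∀ᶠ t : ℝ≥0 in atTop, w (c * t) ≤ C * (t * u t)) : PrecDil u w := by
  rcases hmg with ⟨H, hH, hm⟩ | ⟨H, hH, hm⟩
  · have hH0 : 0 < H := zero_lt_one.trans_le hH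
    have hlim : Tendsto (fun t : ℝ≥0 => H * t) atTop atTop := tendsto_id.const_mul_atTop hH0
    refine ⟨c * H, one_le_mul hc hH, IsBigO.of_bound (C * H * Real.exp H) ?_⟩
    filter_upwards [hlim.eventually h, eventually_mul_comp_mul_le_one u le_rfl] with t h1 h2
    rw [Real.norm_of_nonneg (w.pos _).le, Real.norm_of_nonneg (u.pos _).le, mul_assoc]
    rw [one_mul] at h2
    refine h1.trans ?_
    have h3 := hm t
    have hu := u.pos t
    calc C * (((H * t : ℝ≥0) : ℝ) * u (H * t))
        ≤ C * ((H * t : ℝ) * (Real.exp H * u t ^ 2)) := by push_cast; gcongr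
      _ = C * H * Real.exp H * u t * (t * u t) := by ring
      _ ≤ C * H * Real.exp H * u t * 1 := by gcongr
      _ = C * H * Real.exp H * u t := by ring
  · refine ⟨H * c, one_le_mul hH hc, IsBigO.of_bound (C * Real.exp H) ?_⟩
    filter_upwards [h, eventually_mul_comp_mul_le_one w hc] with t h1 h2
    rw [Real.norm_of_nonneg (w.pos _).le, Real.norm_of_nonneg (u.pos _).le, mul_assoc]
    have hu := u.pos t
    have hw := w.pos (c * t)
    calc w (H * (c * t)) ≤ Real.exp H * w (c * t) ^ 2 := hm _
      _ = Real.exp H * w (c * t) * w (c * t) := by ring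
      _ ≤ Real.exp H * w (c * t) * (C * (t * u t)) := by gcongr
      _ = Real.exp H * C * u t * (t * w (c * t)) := by ring
      _ ≤ Real.exp H * C * u t * 1 := by gcongr
      _ = C * Real.exp H * u t := by ring

/-- The common sink of all the implications towards `PrecDil u w`: it is enough to bound `w` by the
moments of `u`. -/
theorem precDil_of_eventually_le_assocSeq {u w : Weight} (hu : u.Normalized) (huc : u.IsConvex)
    (hmg : u.ModerateGrowth ∨ w.ModerateGrowth) {c : ℝ≥0} (hc : 1 ≤ c) {C : ℝ}
    (h : ∀ᶠ t : ℝ≥0 in atTop, ∀ j : ℕ, (t : ℝ) ^ j * w (c * t) ≤ C * assocSeq u j) :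
    PrecDil u w := by
  have hC : 0 < C := by
    obtain ⟨t, ht⟩ := h.exists
    have h0 := ht 0
    rw [pow_zero, one_mul] at h0
    exact pos_of_mul_pos_left ((w.pos _).trans_le h0) (assocSeq_pos u 0).le
  refine precDil_of_eventually_le_mul hmg hc hC ?_
  filter_upwards [h, eventually_ge_atTop 1] with t h1 h2
  obtain ⟨j, hj⟩ := exists_assocSeq_le hu huc h2
  have ht : (0 : ℝ) < t := by exact_mod_cast zero_lt_one.trans_le h2
  have h3 := (h1 j).trans (mul_le_mul_of_nonneg_left hj hC.le)
  rw [pow_succ] at h3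
  refine le_of_mul_le_mul_left ?_ (pow_pos ht j)
  linarith

theorem assocSeq_le_of_forall_le {u w : Weight} {c : ℕ+} {C : ℝ} (hC : 0 < C)
    (h : ∀ t : ℝ≥0, w ((c : ℕ) * t) ≤ C * u t) (j : ℕ) :
    assocSeq w j ≤ C * (c : ℝ) ^ j * assocSeq u j := by
  refine assocSeq_le fun t ht => ?_
  have hc : (0 : ℝ≥0) < (c : ℕ) := by exact_mod_cast c.pos
  obtain ⟨s, rfl⟩ : ∃ s : ℝ≥0, t = (c : ℕ) * s := ⟨t / (c : ℕ), by field_simp⟩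
  have hs : 0 < s := pos_of_mul_pos_right ht zero_le
  have h2 := le_assocSeq u j s hs
  push_cast
  rw [mul_pow]
  calc (c : ℝ) ^ j * (s : ℝ) ^ j * w ((c : ℕ) * s)
      ≤ (c : ℝ) ^ j * (s : ℝ) ^ j * (C * u s) := by gcongr; exact h s
    _ = C * (c : ℝ) ^ j * ((s : ℝ) ^ j * u s) := by ring
    _ ≤ _ := by gcongr

theorem seqPrec_of_precDil {u w : Weight} (h : PrecDil u w) :
    SeqPrec (assocSeq w) (assocSeq u) := by
  obtain ⟨c, C, hC, h⟩ := exists_forall_le_of_precDil h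
  refine ⟨max 1 C * c, ?_⟩
  rintro _ ⟨j, hj, rfl⟩
  have hu := assocSeq_pos u j
  have hw := assocSeq_pos w j
  have hc : (0 : ℝ) < c := by exact_mod_cast c.pos
  have hC1 : C ≤ max 1 C ^ j :=
    (le_max_right 1 C).trans (le_self_pow₀ (le_max_left _ _) (by omega))
  have hpos : 0 ≤ max 1 C * (c : ℝ) := by positivity
  rw [one_div, Real.rpow_inv_le_iff_of_pos (by positivity) hpos (by exact_mod_cast hj),
    Real.rpow_natCast, div_le_iff₀ hu, mul_pow]
  refine (assocSeq_le_of_forall_le hC h j).trans ?_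
  gcongr

/-- The root bound of `SeqPrec` concerns `j ≥ 1` only; both sequences are `1` at `j = 0`. -/
theorem exists_assocSeq_le_pow_mul {u w : Weight} (hu : u.Normalized) (hw : w.Normalized)
    (h : SeqPrec (assocSeq w) (assocSeq u)) :
    ∃ A : ℝ≥0, 1 ≤ A ∧ ∀ j, assocSeq w j ≤ (A : ℝ) ^ j * assocSeq u j := by
  obtain ⟨B, hB⟩ := h
  refine ⟨max 1 B.toNNReal, le_max_left _ _, fun j => ?_⟩
  rcases Nat.eq_zero_or_pos j with rfl | hj
  · simp [assocSeq_zero hu, assocSeq_zero hw]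
  have hup := assocSeq_pos u j
  have hwp := assocSeq_pos w j
  have h1 := hB ⟨j, hj, rfl⟩
  have h2 : B ≤ (max 1 B.toNNReal : ℝ≥0) :=
    (Real.le_coe_toNNReal B).trans (by exact_mod_cast le_max_right _ _)
  have h3 := h1.trans h2
  rwa [one_div, Real.rpow_inv_le_iff_of_pos (by positivity) (NNReal.coe_nonneg _)
    (by exact_mod_cast hj), Real.rpow_natCast, div_le_iff₀ hup] at h3

theorem precDil_of_seqPrec {u w : Weight} (hu : u.Normalized) (hw : w.Normalized)
    (huc : u.IsConvex) (hmg : u.ModerateGrowth ∨ w.ModerateGrowth)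
    (h : SeqPrec (assocSeq w) (assocSeq u)) : PrecDil u w := by
  obtain ⟨A, hA, h⟩ := exists_assocSeq_le_pow_mul hu hw h
  refine precDil_of_eventually_le_assocSeq hu huc hmg hA (C := 1)
    (Eventually.of_forall fun t j => ?_)
  have hA0 : (0 : ℝ) < A := by exact_mod_cast zero_lt_one.trans_le hA
  have h1 := (le_assocSeq_of_normalized hw j (A * t)).trans (h j)
  rw [NNReal.coe_mul, mul_pow, mul_assoc] at h1
  simpa using le_of_mul_le_mul_left h1 (pow_pos hA0 j)

/-! ### The weight associated with a moment sequence -/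

theorem seqWeight_pos (M : ℕ → ℝ) (t : ℝ≥0) : 0 < seqWeight M t := Real.exp_pos _

theorem seqWeight_le_div (v : Weight) {t : ℝ≥0} (ht : 0 < t) (j : ℕ) :
    seqWeight (assocSeq v) t ≤ assocSeq v j / (t : ℝ) ^ j := by
  have ht0 : (0 : ℝ) < t := by exact_mod_cast ht
  have hM := assocSeq_pos v j
  have h : Real.log ((t : ℝ) ^ j / assocSeq v j) ≤ assocFun (assocSeq v) t := by
    rw [assocFun, if_neg ht.ne']
    exact le_ciSup (assocFun_bddAbove v t ht) j
  rw [seqWeight, ← Real.le_log_iff_exp_le (by positivity), ← inv_div, Real.log_inv]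
  exact neg_le_neg h

theorem le_seqWeight (v : Weight) {t : ℝ≥0} (ht : 0 < t) {B : ℝ} (hB : 0 < B)
    (h : ∀ j, B ≤ assocSeq v j / (t : ℝ) ^ j) : B ≤ seqWeight (assocSeq v) t := by
  rw [seqWeight, ← Real.log_le_iff_le_exp hB, assocFun, if_neg ht.ne', le_neg]
  refine ciSup_le fun j => ?_
  rw [← inv_div, Real.log_inv]
  exact neg_le_neg (Real.log_le_log hB (h j))

theorem self_le_seqWeight (v : Weight) {t : ℝ≥0} (ht : 0 < t) :
    v t ≤ seqWeight (assocSeq v) t := by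
  have ht0 : (0 : ℝ) < t := by exact_mod_cast ht
  refine le_seqWeight v ht (v.pos t) fun j => ?_
  rw [le_div_iff₀ (pow_pos ht0 j), mul_comm]
  exact le_assocSeq v j t ht

theorem precDil_seqWeight_of_precDil {u w : Weight} (h : PrecDil u w) :
    PrecDil (seqWeight (assocSeq u)) (seqWeight (assocSeq w)) := by
  obtain ⟨c, C, hC, h⟩ := exists_forall_le_of_precDil h
  have hc : (0 : ℝ≥0) < (c : ℕ) := by exact_mod_cast c.pos
  refine ⟨(c : ℕ), by exact_mod_cast c.pos, IsBigO.of_bound C ?_⟩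
  filter_upwards [eventually_gt_atTop 0] with t ht
  have ht0 : (0 : ℝ) < t := by exact_mod_cast ht
  have hc0 : (0 : ℝ) < c := by exact_mod_cast hc
  rw [Real.norm_of_nonneg (seqWeight_pos _ _).le, Real.norm_of_nonneg (seqWeight_pos _ _).le,
    ← div_le_iff₀' hC]
  refine le_seqWeight u ht (div_pos (seqWeight_pos _ _) hC) fun j => ?_
  rw [div_le_iff₀' hC]
  refine (seqWeight_le_div w (mul_pos hc ht) j).trans ?_
  rw [div_le_iff₀ (pow_pos (by exact_mod_cast mul_pos hc ht) j)]
  refine (assocSeq_le_of_forall_le hC h j).trans (le_of_eq ?_)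
  push_cast
  rw [mul_pow]
  field_simp

theorem precDil_of_precDil_seqWeight {u w : Weight} (hu : u.Normalized) (huc : u.IsConvex)
    (hmg : u.ModerateGrowth ∨ w.ModerateGrowth)
    (h : PrecDil (seqWeight (assocSeq u)) (seqWeight (assocSeq w))) : PrecDil u w := by
  obtain ⟨c, hc, h⟩ := h
  obtain ⟨C, hC, hb⟩ := h.exists_pos
  refine precDil_of_eventually_le_assocSeq hu huc hmg hc (C := C) ?_
  filter_upwards [hb.bound, eventually_gt_atTop 0] with t h1 ht j
  have ht0 : (0 : ℝ) < t := by exact_mod_cast ht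
  rw [Real.norm_of_nonneg (seqWeight_pos _ _).le, Real.norm_of_nonneg (seqWeight_pos _ _).le] at h1
  have h2 := (self_le_seqWeight w (mul_pos (zero_lt_one.trans_le hc) ht)).trans
    (h1.trans (mul_le_mul_of_nonneg_left (seqWeight_le_div u ht j) hC.le))
  rwa [← mul_div_assoc, le_div_iff₀' (pow_pos ht0 j)] at h2

/-! ### Continuous inclusions -/

/-- The inclusion `H^∞_v ⊆ H^∞_w` for weights with `w ≤ C v`. -/
def HInf.inclusion {v w : Weight} (C : ℝ) (h : ∀ t, w t ≤ C * v t) : HInf v →L[ℂ] HInf w :=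
  have hb (f : HInf v) (z : ℂ) : ‖f z‖ * w ‖z‖₊ ≤ C * ‖f‖ := by
    have hC : 0 < C := pos_of_mul_pos_left ((w.pos 0).trans_le (h 0)) (v.pos 0).le
    calc ‖f z‖ * w ‖z‖₊ ≤ ‖f z‖ * (C * v ‖z‖₊) := by gcongr; exact h _
      _ = C * (‖f z‖ * v ‖z‖₊) := by ring
      _ ≤ C * ‖f‖ := by gcongr; exact f.le_norm z
  LinearMap.mkContinuous
    { toFun := fun f => ⟨f.1, f.2.1, C * ‖f‖, by rintro _ ⟨z, rfl⟩; exact hb f z⟩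
      map_add' := fun _ _ => rfl
      map_smul' := fun _ _ => rfl } C fun f => ciSup_le (hb f)

/-- The universal property of the locally convex inductive limit. -/
theorem IndLim.continuous_of_continuous_comp_incl {V : ℕ+ → Weight} {E : Type*} [AddCommGroup E]
    [Module ℂ E] [TopologicalSpace E] [IsTopologicalAddGroup E] [ContinuousSMul ℂ E]
    [LocallyConvexSpace ℝ E] (i : IndLim V →ₗ[ℂ] E)
    (h : ∀ n, Continuous fun f : HInf (V n) => i (incl n f)) : Continuous i := by
  refine continuous_sInf_dom (t := .induced i inferInstance) ⟨fun n => ?_, ?_, ?_, ?_⟩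
    continuous_induced_dom
  · exact continuous_induced_rng.2 (h n)
  · exact topologicalAddGroup_induced i
  · exact continuousSMul_induced i
  · exact LocallyConvexSpace.induced (i.restrictScalars ℝ)

theorem continuouslyIncluded_indLim {u w : Weight} (h : PrecDil u w) :
    ContinuouslyIncluded (IndLim (lowerSystem u)) (IndLim (lowerSystem w)) := by
  obtain ⟨c, C, -, h⟩ := exists_forall_le_of_precDil h
  have hle (n : ℕ+) (t : ℝ≥0) : lowerSystem w (c * n) t ≤ C * lowerSystem u n t := by
    simpa [lowerSystem, Weight.dilate, mul_assoc] using h ((n : ℕ) * t)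
  have hsub : indSubmodule (lowerSystem u) ≤ indSubmodule (lowerSystem w) :=
    iSup_le fun n => le_trans
      (fun f hf => (HInf.inclusion C (hle n) (⟨f, hf⟩ : HInf _)).2)
      (le_iSup (fun n => hInfSubmodule (lowerSystem w n)) (c * n))
  let i : IndLim (lowerSystem u) →ₗ[ℂ] IndLim (lowerSystem w) := Submodule.inclusion hsub
  refine ⟨⟨i, IndLim.continuous_of_continuous_comp_incl i fun n => ?_⟩, fun _ _ => rfl⟩
  exact (IndLim.continuous_incl (c * n)).comp (HInf.inclusion C (hle n)).continuous

theorem ProjLim.continuous_proj {V : ℕ+ → Weight} (n : ℕ+) :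
    Continuous (proj n : ProjLim V → HInf (V n)) :=
  continuous_iff_le_induced.2 (iInf_le _ n)

theorem continuouslyIncluded_projLim {u w : Weight} (h : PrecDil u w) :
    ContinuouslyIncluded (ProjLim (upperSystem u)) (ProjLim (upperSystem w)) := by
  obtain ⟨c, C, -, h⟩ := exists_forall_le_of_precDil h
  have hle (n : ℕ+) (t : ℝ≥0) : upperSystem w n t ≤ C * upperSystem u (c * n) t := by
    have h1 := h (1 / ((c * n : ℕ+) : ℕ) * t)
    have hc : (c : ℝ≥0) ≠ 0 := by exact_mod_cast c.pos.ne'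
    have h2 : ((c : ℕ) : ℝ≥0) * (1 / ((c * n : ℕ+) : ℕ) * t) = 1 / (n : ℕ) * t := by
      push_cast
      field_simp
    rwa [h2] at h1
  have hsub : projSubmodule (upperSystem u) ≤ projSubmodule (upperSystem w) :=
    le_iInf fun n => le_trans
      (iInf_le (fun n => hInfSubmodule (upperSystem u n)) (c * n))
      (fun f hf => (HInf.inclusion C (hle n) (⟨f, hf⟩ : HInf _)).2)
  let i : ProjLim (upperSystem u) →ₗ[ℂ] ProjLim (upperSystem w) := Submodule.inclusion hsub
  refine ⟨⟨i, continuous_iInf_rng.2 fun n => continuous_induced_rng.2 ?_⟩, fun _ _ => rfl⟩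
  exact (HInf.inclusion C (hle n)).continuous.comp (ProjLim.continuous_proj (c * n))

theorem equalAsLCVS_iff {E F : Type} [AddCommGroup E] [Module ℂ E] [TopologicalSpace E]
    [FunLike E ℂ ℂ] [AddCommGroup F] [Module ℂ F] [TopologicalSpace F] [FunLike F ℂ ℂ] :
    EqualAsLCVS E F ↔ ContinuouslyIncluded E F ∧ ContinuouslyIncluded F E := by
  constructor
  · rintro ⟨e, he⟩
    refine ⟨⟨e, he⟩, e.symm, fun f z => ?_⟩
    simpa using (he (e.symm f) z).symm
  · rintro ⟨⟨i, hi⟩, k, hk⟩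
    refine ⟨.equivOfInverse i k (fun f => ?_) fun f => ?_, hi⟩
    · exact DFunLike.ext _ _ fun z => by rw [hk, hi]
    · exact DFunLike.ext _ _ fun z => by rw [hi, hk]

/-! ### Test functions -/

/-- The entire function `∑ z ^ j / (2 ^ j M_j)`, where `M` is the associated sequence of `v`. Its
value at `2 t` dominates `t ^ j / M_j` for every `j`, hence `1 / v_M(t)`. -/
def extremalFun (v : Weight) (z : ℂ) : ℂ := ∑' j : ℕ, z ^ j / ((2 ^ j * assocSeq v j : ℝ) : ℂ)

theorem norm_extremalFun_term_le {v : Weight} (hv : v.Normalized) (j : ℕ) {z : ℂ} {r : ℝ≥0}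
    (hz : ‖z‖₊ ≤ r) : ‖z ^ j / ((2 ^ j * assocSeq v j : ℝ) : ℂ)‖ ≤ (1 / 2) ^ j * (v r)⁻¹ := by
  have hM := assocSeq_pos v j
  have hvr := v.pos r
  have hz' : ‖z‖ ≤ r := by exact_mod_cast hz
  rw [norm_div, norm_pow, Complex.norm_real, Real.norm_of_nonneg (by positivity),
    div_le_iff₀ (by positivity)]
  calc ‖z‖ ^ j ≤ (r : ℝ) ^ j := by gcongr
    _ ≤ assocSeq v j / v r := (le_div_iff₀ hvr).2 (le_assocSeq_of_normalized hv j r)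
    _ = (1 / 2) ^ j * (v r)⁻¹ * (2 ^ j * assocSeq v j) := by
      rw [div_pow, one_pow]
      field_simp

theorem summable_half_pow_mul (B : ℝ) : Summable fun j : ℕ => (1 / 2 : ℝ) ^ j * B :=
  summable_geometric_two.mul_right B

theorem extremalFun_mem {v : Weight} (hv : v.Normalized) : extremalFun v ∈ hInfSubmodule v := by
  constructor
  · intro z
    have h : DifferentiableOn ℂ (extremalFun v) (Metric.ball 0 (‖z‖ + 1)) := by
      refine Complex.differentiableOn_tsum_of_summable_norm
        (summable_half_pow_mul (v (‖z‖₊ + 1))⁻¹)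
        (fun j => ((differentiable_id.pow j).div_const _).differentiableOn) Metric.isOpen_ball
        fun j x hx => norm_extremalFun_term_le hv j ?_
      rw [mem_ball_zero_iff] at hx
      exact_mod_cast hx.le
    exact h.differentiableAt (Metric.isOpen_ball.mem_nhds (by simp))
  · refine ⟨2, ?_⟩
    rintro _ ⟨z, rfl⟩
    have h := tsum_of_norm_bounded ((summable_half_pow_mul (v ‖z‖₊)⁻¹).hasSum)
      fun j => norm_extremalFun_term_le hv j (le_refl ‖z‖₊)
    rw [tsum_mul_right, tsum_geometric_two] at h
    rwa [← le_div_iff₀ (v.pos _), div_eq_mul_inv]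

theorem pow_le_norm_extremalFun {v : Weight} (hv : v.Normalized) (t : ℝ≥0) (j : ℕ) :
    (t : ℝ) ^ j / assocSeq v j ≤ ‖extremalFun v (((2 * t : ℝ≥0) : ℝ) : ℂ)‖ := by
  have hsum : Summable fun j : ℕ => ((2 * t : ℝ≥0) : ℝ) ^ j / (2 ^ j * assocSeq v j) := by
    refine .of_norm_bounded (summable_half_pow_mul (v (2 * t))⁻¹) fun k => ?_
    have := norm_extremalFun_term_le hv k (z := (((2 * t : ℝ≥0) : ℝ) : ℂ)) (r := 2 * t) (by simp)
    rw [← Complex.ofReal_pow, ← Complex.ofReal_div, Complex.norm_real] at this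
    exact this
  have heq : extremalFun v (((2 * t : ℝ≥0) : ℝ) : ℂ) =
      ((∑' j : ℕ, ((2 * t : ℝ≥0) : ℝ) ^ j / (2 ^ j * assocSeq v j) : ℝ) : ℂ) := by
    rw [extremalFun, Complex.ofReal_tsum]
    simp only [Complex.ofReal_div, Complex.ofReal_pow]
  have hnn (k : ℕ) : 0 ≤ ((2 * t : ℝ≥0) : ℝ) ^ k / (2 ^ k * assocSeq v k) := by
    have := assocSeq_pos v k
    positivity
  rw [heq, Complex.norm_real, Real.norm_of_nonneg (tsum_nonneg hnn)]
  refine le_trans (le_of_eq ?_) (hsum.le_tsum j fun k _ => hnn k)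
  push_cast
  rw [mul_pow, mul_div_mul_left _ _ (by positivity)]

/-- The function `extremalFun u` lies in the first step of the system of `u`, and where it lands in
the system of `w` bounds `w` by the moments of `u`. -/
theorem precDil_of_continuouslyIncluded_indLim {u w : Weight} (hu : u.Normalized)
    (huc : u.IsConvex) (hmg : u.ModerateGrowth ∨ w.ModerateGrowth)
    (h : ContinuouslyIncluded (IndLim (lowerSystem u)) (IndLim (lowerSystem w))) :
    PrecDil u w := by
  obtain ⟨i, hi⟩ := h
  have hmem : extremalFun u ∈ indSubmodule (lowerSystem u) := by
    refine (mem_indSubmodule_lowerSystem u _).2 ⟨1, ?_⟩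
    simpa [hInfSubmodule, lowerSystem, Weight.dilate] using extremalFun_mem hu
  have hmem' : extremalFun u ∈ indSubmodule (lowerSystem w) := by
    have h1 : ((i ⟨_, hmem⟩ : IndLim (lowerSystem w)) : ℂ → ℂ) = extremalFun u :=
      funext fun z => hi ⟨_, hmem⟩ z
    exact h1 ▸ (i ⟨_, hmem⟩).2
  obtain ⟨n, -, C, hC⟩ := (mem_indSubmodule_lowerSystem w _).1 hmem'
  have hn : (1 : ℝ≥0) ≤ (n : ℕ) := by exact_mod_cast n.pos
  refine precDil_of_eventually_le_assocSeq hu huc hmg (c := (n : ℕ) * 2) (C := C)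
    (one_le_mul hn one_le_two) (Eventually.of_forall fun t j => ?_)
  have hw := w.pos ((n : ℕ) * 2 * t)
  have h1 : ‖extremalFun u (((2 * t : ℝ≥0) : ℝ) : ℂ)‖ * w ((n : ℕ) * 2 * t) ≤ C := by
    have := hC ⟨(((2 * t : ℝ≥0) : ℝ) : ℂ), rfl⟩
    simpa [lowerSystem, Weight.dilate, mul_assoc] using this
  have h2 := (mul_le_mul_of_nonneg_right (pow_le_norm_extremalFun hu t j) hw.le).trans h1
  rwa [div_mul_eq_mul_div, div_le_iff₀ (assocSeq_pos u j)] at h2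

theorem pow_mul_upperSystem_le {v : Weight} (hv : v.Normalized) (n : ℕ+) (j : ℕ) (t : ℝ≥0) :
    (t : ℝ) ^ j * upperSystem v n t ≤ (n : ℝ) ^ j * assocSeq v j := by
  have hn : (0 : ℝ) < n := by exact_mod_cast n.pos
  have h := le_assocSeq_of_normalized hv j (1 / (n : ℕ) * t)
  calc (t : ℝ) ^ j * upperSystem v n t
      = (n : ℝ) ^ j * (((1 / (n : ℕ) * t : ℝ≥0) : ℝ) ^ j * v (1 / (n : ℕ) * t)) := by
        change (t : ℝ) ^ j * v (1 / (n : ℕ) * t) = _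
        rw [← mul_assoc, ← mul_pow]
        push_cast
        rw [← mul_assoc, mul_one_div_cancel hn.ne', one_mul]
    _ ≤ _ := by gcongr

theorem monomial_mem {v : Weight} (hv : v.Normalized) (j : ℕ) :
    (fun z : ℂ => z ^ j) ∈ projSubmodule (upperSystem v) := by
  refine (Submodule.mem_iInf _).2 fun n => ⟨differentiable_id.pow j, (n : ℝ) ^ j * assocSeq v j, ?_⟩
  rintro _ ⟨z, rfl⟩
  simpa using pow_mul_upperSystem_le hv n j ‖z‖₊

/-- The monomial `z ^ j` as an element of the Fréchet space. -/
def monomialProj {v : Weight} (hv : v.Normalized) (j : ℕ) : ProjLim (upperSystem v) :=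
  ⟨_, monomial_mem hv j⟩

theorem norm_proj_monomialProj_le {v : Weight} (hv : v.Normalized) (j : ℕ) (n : ℕ+) :
    ‖ProjLim.proj n (monomialProj hv j)‖ ≤ (n : ℝ) ^ j * assocSeq v j :=
  ciSup_le fun z => by
    change ‖z ^ j‖ * _ ≤ _
    simpa using pow_mul_upperSystem_le hv n j ‖z‖₊

theorem norm_proj_mono (v : Weight) {m n : ℕ+} (hmn : m ≤ n) (f : ProjLim (upperSystem v)) :
    ‖ProjLim.proj m f‖ ≤ ‖ProjLim.proj n f‖ := by
  refine ciSup_le fun z => le_trans ?_ (HInf.le_norm (ProjLim.proj n f) z)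
  refine mul_le_mul_of_nonneg_left (v.antitone ?_) (norm_nonneg _)
  have hm : (0 : ℝ≥0) < (m : ℕ) := by exact_mod_cast m.pos
  have : ((m : ℕ) : ℝ≥0) ≤ (n : ℕ) := by exact_mod_cast hmn
  gcongr

/-- The norms of the steps increase with the index, so that their balls form a neighbourhood base
at `0` and not just a subbase. -/
theorem exists_norm_proj_lt_subset {v : Weight} {s : Set (ProjLim (upperSystem v))}
    (hs : s ∈ 𝓝 0) : ∃ n : ℕ+, ∃ δ : ℝ, 0 < δ ∧ ∀ f, ‖ProjLim.proj n f‖ < δ → f ∈ s := by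
  rw [nhds_iInf] at hs
  have hcomap (n : ℕ+) : @nhds _ (.induced (ProjLim.proj n) inferInstance) 0 =
      comap (norm ∘ (ProjLim.proj n : ProjLim (upperSystem v) → _)) (𝓝 (0 : ℝ)) := by
    rw [nhds_induced, map_zero, ← comap_norm_nhds_zero, comap_comap]
  simp only [hcomap] at hs
  have hb (n : ℕ+) := (nhds_basis_zero_abs_lt ℝ).comap
    (norm ∘ (ProjLim.proj n : ProjLim (upperSystem v) → _))
  have hdir : Directed (· ≥ ·) fun n : ℕ+ =>
      comap (norm ∘ (ProjLim.proj n : ProjLim (upperSystem v) → _)) (𝓝 (0 : ℝ)) := by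
    refine directed_of_isDirected_le fun m n hmn => ?_
    refine ((hb n).le_basis_iff (hb m)).2 fun ε hε => ⟨ε, hε, fun f hf => ?_⟩
    simp only [Function.comp, Set.mem_preimage, Set.mem_ofPred_eq, abs_norm] at hf ⊢
    exact (norm_proj_mono v hmn f).trans_lt hf
  obtain ⟨n, hn⟩ := (mem_iInf_of_directed hdir s).1 hs
  obtain ⟨δ, hδ, hsub⟩ := (hb n).mem_iff.1 hn
  exact ⟨n, δ, hδ, fun f hf => hsub (by simpa using hf)⟩

theorem precDil_of_continuouslyIncluded_projLim {u w : Weight} (hu : u.Normalized)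
    (huc : u.IsConvex) (hmg : u.ModerateGrowth ∨ w.ModerateGrowth)
    (h : ContinuouslyIncluded (ProjLim (upperSystem u)) (ProjLim (upperSystem w))) :
    PrecDil u w := by
  obtain ⟨i, hi⟩ := h
  have hcont : Continuous fun f => ‖ProjLim.proj 1 (i f)‖ :=
    continuous_norm.comp ((ProjLim.continuous_proj 1).comp i.continuous)
  have hnhds : {f | ‖ProjLim.proj 1 (i f)‖ < 1} ∈ 𝓝 0 := by
    refine hcont.continuousAt.eventually (gt_mem_nhds ?_)
    simp
  obtain ⟨n, δ, hδ, hsub⟩ := exists_norm_proj_lt_subset hnhds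
  have hn0 : (0 : ℝ) < n := by exact_mod_cast n.pos
  refine precDil_of_eventually_le_assocSeq hu huc hmg (c := (n : ℕ)) (C := 2 / δ)
    (by exact_mod_cast n.pos) (Eventually.of_forall fun t j => ?_)
  have hM := assocSeq_pos u j
  -- The monomial `z ^ j`, scaled into the ball of radius `δ`.
  set r : ℝ := δ / 2 / ((n : ℝ) ^ j * assocSeq u j) with hr
  have hr0 : 0 < r := by positivity
  have h1 : ‖ProjLim.proj 1 (i ((r : ℂ) • monomialProj hu j))‖ < 1 := by
    refine hsub _ ?_
    rw [map_smul, norm_smul, Complex.norm_real, Real.norm_of_nonneg hr0.le]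
    calc r * ‖ProjLim.proj n (monomialProj hu j)‖ ≤ r * ((n : ℝ) ^ j * assocSeq u j) := by
          gcongr; exact norm_proj_monomialProj_le hu j n
      _ = δ / 2 := by rw [hr]; field_simp
      _ < δ := half_lt_self hδ
  have h2 := (HInf.le_norm (ProjLim.proj 1 (i ((r : ℂ) • monomialProj hu j)))
    (((n : ℕ) * t : ℝ≥0) : ℝ)).trans h1.le
  have h3 : (ProjLim.proj 1 (i ((r : ℂ) • monomialProj hu j)) : HInf (upperSystem w 1))
      (((n : ℕ) * t : ℝ≥0) : ℝ) = (r : ℂ) * ((((n : ℕ) * t : ℝ≥0) : ℝ) : ℂ) ^ j :=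
    hi ((r : ℂ) • monomialProj hu j) _
  rw [h3, norm_mul, norm_pow, Complex.norm_real, Complex.norm_real,
    Real.norm_of_nonneg hr0.le] at h2
  have h4 : r * ((n : ℝ) * t) ^ j * w ((n : ℕ) * t) ≤ 1 := by
    simpa [upperSystem, Weight.dilate] using h2
  rw [hr, mul_pow] at h4
  rw [div_mul_eq_mul_div, le_div_iff₀ hδ]
  field_simp at h4
  linarith

end WeightedEntire

end

open WeightedEntire
theorem mainTheorem6 (u w : Weight) (hu : u.Normalized) (hw : w.Normalized)
    (huc : u.IsConvex) (hmg : u.ModerateGrowth ∨ w.ModerateGrowth) :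
    [PrecDil u w,
      ContinuouslyIncluded (IndLim (lowerSystem u)) (IndLim (lowerSystem w)),
      ContinuouslyIncluded (ProjLim (upperSystem u)) (ProjLim (upperSystem w))].TFAE ∧
    (w.IsConvex →
      [PrecDil u w,
        ContinuouslyIncluded (IndLim (lowerSystem u)) (IndLim (lowerSystem w)),
        ContinuouslyIncluded (ProjLim (upperSystem u)) (ProjLim (upperSystem w)),
        SeqPrec (assocSeq w) (assocSeq u),
        PrecDil (seqWeight (assocSeq u)) (seqWeight (assocSeq w))].TFAE) ∧
    (w.IsConvex → u.ModerateGrowth → w.ModerateGrowth →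
      (SimDil u w ↔ EqualAsLCVS (IndLim (lowerSystem u)) (IndLim (lowerSystem w))) ∧
      (SimDil u w ↔ EqualAsLCVS (ProjLim (upperSystem u)) (ProjLim (upperSystem w)))) := by
  have hind : PrecDil u w ↔
      ContinuouslyIncluded (IndLim (lowerSystem u)) (IndLim (lowerSystem w)) :=
    ⟨continuouslyIncluded_indLim, precDil_of_continuouslyIncluded_indLim hu huc hmg⟩
  have hproj : PrecDil u w ↔
      ContinuouslyIncluded (ProjLim (upperSystem u)) (ProjLim (upperSystem w)) :=
    ⟨continuouslyIncluded_projLim, precDil_of_continuouslyIncluded_projLim hu huc hmg⟩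
  refine ⟨?_, fun _ => ?_, fun hwc hum _ => ⟨?_, ?_⟩⟩
  · tfae_have 1 ↔ 2 := hind
    tfae_have 1 ↔ 3 := hproj
    tfae_finish
  · tfae_have 1 ↔ 2 := hind
    tfae_have 1 ↔ 3 := hproj
    tfae_have 1 ↔ 4 := ⟨seqPrec_of_precDil, precDil_of_seqPrec hu hw huc hmg⟩
    tfae_have 1 ↔ 5 :=
      ⟨precDil_seqWeight_of_precDil, precDil_of_precDil_seqWeight hu huc hmg⟩
    tfae_finish
  · rw [equalAsLCVS_iff, ← hind]
    exact and_congr_right' ⟨continuouslyIncluded_indLim,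
      precDil_of_continuouslyIncluded_indLim hw hwc (.inr hum)⟩
  · rw [equalAsLCVS_iff, ← hproj]
    exact and_congr_right' ⟨continuouslyIncluded_projLim,
      precDil_of_continuouslyIncluded_projLim hw hwc (.inr hum)⟩
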